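/- A convex domain is a compact convex set $\Omega\subset\mathbb R^2$ with nonempty interior. Let $\mathcal U_\Omega$ be the class of continuous concave functions $u$ on $\Omega$ such that $u|_{\partial\Omega}=0$ and the gradient $\nabla u$ is uniformly bounded over all points of $\operatorname{int}\Omega$ where it is defined. For $h\in\mathbb R^2$ put $u_h=(\nabla u,h)$ (defined almost everywhere on $\Omega$), let $u_x,u_y$ be the partial derivatives, and let $\|f\|_\infty=\operatorname{ess\,sup}_{\Omega}|f|$. Set $$K_\infty(\Omega)=\sup_{u\in\mathcal U_\Omega,\,u\ne0}\frac{\|u_x\|_\infty}{\|u_y\|_\infty},\qquad k_\infty(\Omega)=\inf_{u\in\mathcal U_\Omega,\,u\ne0}\frac{\|u_x\|_\infty}{\|u_y\|_\infty},$$ with values in $[0,+\infty]$; the quotient $K_\infty(\Omega)/k_\infty(\Omega)$ is read as $+\infty$ if $K_\infty(\Omega)=+\infty$ or $k_\infty(\Omega)=0$. Then $$\inf_\Omega\frac{K_\infty(\Omega)}{k_\infty(\Omega)}=1,$$ where the infimum is over all convex domains, and it is attained at every (nondegenerate) parallelogram $\Omega$ whose sides are non-vertical and have slopes of equal absolute value.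 More generally, for all nonzero vectors $h_1,h_2\in\mathbb R^2$, $$\inf_\Omega\ \frac{\sup_{u\in\mathcal U_\Omega,\,u\ne0}\ \|u_{h_1}\|_\infty/\|u_{h_2}\|_\infty}{\inf_{u\in\mathcal U_\Omega,\,u\ne0}\ \|u_{h_1}\|_\infty/\|u_{h_2}\|_\infty}=1$$ (with the same convention for the quotient), and the infimum is attained at every (nondegenerate) parallelogram $\Omega$ with sides parallel to $h_1+h_2$ and $h_1-h_2$ (such parallelograms exist precisely when $h_1,h_2$ are not collinear). -/

import Mathlib

open MeasureTheory Set
open scoped ENNReal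

/-- The Euclidean plane. -/
abbrev Plane : Type := EuclideanSpace ℝ (Fin 2)

/-- The unit vector of the `x`-axis. -/
noncomputable def dirX : Plane := EuclideanSpace.single 0 1

/-- The unit vector of the `y`-axis. -/
noncomputable def dirY : Plane := EuclideanSpace.single 1 1

/-- Convex compact domains of the plane: compact convex sets with interior points. -/
structure IsConvexDomain (Ω : Set Plane) : Prop where
  isCompact : IsCompact Ω
  convex : Convex ℝ Ω
  interior_nonempty : (interior Ω).Nonempty

/-- The class `𝒰_Ω`: continuous concave functions on `Ω` that vanish on the boundary of `Ω` and
whose gradient is uniformly bounded over the interior points of `Ω` where it exists. The values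
of `u` outside `Ω` play no role. -/
structure IsAdmissible (Ω : Set Plane) (u : Plane → ℝ) : Prop where
  continuousOn : ContinuousOn u Ω
  concaveOn : ConcaveOn ℝ Ω u
  eq_zero_of_mem_frontier : ∀ z ∈ frontier Ω, u z = 0
  gradient_bounded : ∃ C : ℝ, ∀ z ∈ interior Ω, DifferentiableAt ℝ u z → ‖fderiv ℝ u z‖ ≤ C

/-- The nonzero elements of `𝒰_Ω`. -/
def admissibleNonzero (Ω : Set Plane) : Set (Plane → ℝ) :=
  {u | IsAdmissible Ω u ∧ ∃ z ∈ Ω, u z ≠ 0}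

/-- The norm `‖u_h‖_p` in `L_p(Ω)` of the derivative `u_h = (∇u, h)` of `u` along `h`. (A function
in `𝒰_Ω` is differentiable at almost every point of `Ω`.) -/
noncomputable def dirNorm (p : ℝ≥0∞) (Ω : Set Plane) (u : Plane → ℝ) (h : Plane) : ℝ≥0∞ :=
  eLpNorm (fun z => fderiv ℝ u z h) p (volume.restrict Ω)

/-- The supremum of `‖u_{h₁}‖_p / ‖u_{h₂}‖_p` over the nonzero `u ∈ 𝒰_Ω`, in `[0, ∞]`. -/
noncomputable def supRatio (p : ℝ≥0∞) (Ω : Set Plane) (h₁ h₂ : Plane) : ℝ≥0∞ :=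
  ⨆ u ∈ admissibleNonzero Ω, dirNorm p Ω u h₁ / dirNorm p Ω u h₂

/-- The infimum of `‖u_{h₁}‖_p / ‖u_{h₂}‖_p` over the nonzero `u ∈ 𝒰_Ω`. -/
noncomputable def infRatio (p : ℝ≥0∞) (Ω : Set Plane) (h₁ h₂ : Plane) : ℝ≥0∞ :=
  ⨅ u ∈ admissibleNonzero Ω, dirNorm p Ω u h₁ / dirNorm p Ω u h₂

/-- `K_p(Ω)`, the supremum of `‖u_x‖_p / ‖u_y‖_p`. -/
noncomputable def bigK (p : ℝ≥0∞) (Ω : Set Plane) : ℝ≥0∞ := supRatio p Ω dirX dirY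

/-- `k_p(Ω)`, the infimum of `‖u_x‖_p / ‖u_y‖_p`. -/
noncomputable def smallK (p : ℝ≥0∞) (Ω : Set Plane) : ℝ≥0∞ := infRatio p Ω dirX dirY

/-- The parallelogram with vertices `c`, `c + v`, `c + w`, `c + v + w`; it is nondegenerate when
`v` and `w` are linearly independent. -/
def parallelogram (c v w : Plane) : Set Plane :=
  {z | ∃ s ∈ Icc (0 : ℝ) 1, ∃ t ∈ Icc (0 : ℝ) 1, z = c + s • v + t • w}

/-!
The supremum of the quotients is at least their infimum, and all quotients are finite and nonzero,
so `1` is a lower bound.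

On a parallelogram with sides parallel to `h + k` and `h - k`, the norms of `u_h` and `u_k` agree.
Let `y = z + T h` be the point where the ray from an interior point `z` in the direction `h` leaves
the parallelogram. One of the two side directions is that of a side through `y`; the projection `x`
of `z` to this side along the other one is `z + (T / 2) (h ± k)`. In the small parallelogram with
vertices `z`, `x`, `y` the diagonals are parallel to `h` and `k` and meet in the midpoint `q` of
`z` and `y`. Since `u` vanishes at `x` and at `y`, concavity gives
`u z / 2 ≤ u q = u q - u x ≤ (T / 2) ‖u_k‖_∞` and `-u_h(z) ≤ u z / T`, hence `-u_h(z) ≤ ‖u_k‖_∞`.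
-/

open Filter Module Topology

theorem concaveOn_one_sub_gauge {E : Type*} [AddCommGroup E] [Module ℝ E] {s : Set E}
    (hs : Convex ℝ s) (habs : Absorbent ℝ s) : ConcaveOn ℝ univ fun z => 1 - gauge s z := by
  refine ⟨convex_univ, fun x _ y _ a b ha hb hab => ?_⟩
  have hsubadd := gauge_add_le hs habs (a • x) (b • y)
  rw [gauge_smul_of_nonneg ha, gauge_smul_of_nonneg hb] at hsubadd
  simp only [smul_eq_mul] at hsubadd ⊢
  linarith

section Concave

variable {E : Type*} [NormedAddCommGroup E] [NormedSpace ℝ E] {s : Set E} {u : E → ℝ}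

theorem le_add_fderiv_of_concaveOn (hu : ConcaveOn ℝ s u) {z d : E} (hz : z ∈ s) (hd : z + d ∈ s)
    (hdiff : DifferentiableAt ℝ u z) : u (z + d) ≤ u z + fderiv ℝ u z d := by
  have hline : ConcaveOn ℝ (AffineMap.lineMap (k := ℝ) z (z + d) ⁻¹' s)
      (u ∘ AffineMap.lineMap (k := ℝ) z (z + d)) := hu.comp_affineMap _
  have hderiv : HasDerivAt (u ∘ AffineMap.lineMap (k := ℝ) z (z + d)) (fderiv ℝ u z d) 0 := by
    have hlineMap : HasDerivAt (AffineMap.lineMap (k := ℝ) z (z + d)) d 0 := by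
      simpa using AffineMap.hasDerivAt_lineMap (a := z) (b := z + d) (x := (0 : ℝ))
    refine HasFDerivAt.comp_hasDerivAt (0 : ℝ) ?_ hlineMap
    simpa using hdiff.hasFDerivAt
  have hslope := hline.slope_le_of_hasDerivAt (x := 0) (y := 1) (by simpa using hz)
    (by simpa using hd) zero_lt_one hderiv
  simp only [slope_def_field, Function.comp_apply, AffineMap.lineMap_apply_one,
    AffineMap.lineMap_apply_zero, sub_zero, div_one] at hslope
  linarith

variable [FiniteDimensional ℝ E] [MeasurableSpace E] [BorelSpace E]
  {μ : Measure E} [μ.IsAddHaarMeasure]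

theorem ae_mem_interior_of_convex (hs : Convex ℝ s) : ∀ᵐ z ∂μ.restrict s, z ∈ interior s := by
  rw [← Measure.restrict_congr_set (interior_ae_eq_of_null_frontier (hs.addHaar_frontier μ))]
  exact ae_restrict_mem isOpen_interior.measurableSet

theorem ae_differentiableAt_of_concaveOn (hu : ConcaveOn ℝ s u) :
    ∀ᵐ z ∂μ, z ∈ interior s → DifferentiableAt ℝ u z := by
  refine measure_null_of_locally_null _ fun x hx => ?_
  have hxs : x ∈ interior s := by
    by_contra hxs
    exact hx fun h => absurd h hxs
  obtain ⟨C, t, ht, hLip⟩ := hu.locallyLipschitzOn_interior hxs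
  rw [isOpen_interior.nhdsWithin_eq hxs] at ht
  refine ⟨_, inter_mem_nhdsWithin _ (interior_mem_nhds.2 ht), ?_⟩
  have hae := (hLip.mono interior_subset).ae_differentiableWithinAt_of_mem (μ := μ)
  refine measure_mono_null ?_ (mem_ae_iff.1 hae)
  exact fun z ⟨hz, hzt⟩ hdiff =>
    hz fun _ => (hdiff hzt).differentiableAt (isOpen_interior.mem_nhds hzt)

theorem interior_subset_closure_differentiableAt_of_concaveOn (hu : ConcaveOn ℝ s u)
    {P : E → Prop} (hP : ∀ᵐ z ∂μ.restrict s, P z) :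
    interior s ⊆ closure {z ∈ interior s | DifferentiableAt ℝ u z ∧ P z} := by
  have hPi := (ae_restrict_iff' isOpen_interior.measurableSet).1
    (ae_restrict_of_ae_restrict_of_subset interior_subset hP)
  have hdense := Measure.dense_of_ae ((ae_differentiableAt_of_concaveOn hu).and hPi)
  refine (hdense.open_subset_closure_inter isOpen_interior).trans (closure_mono ?_)
  exact fun z ⟨hz, hdiff, hPz⟩ => ⟨hz, hdiff hz, hPz hz⟩

theorem le_add_mul_abs_of_ae_abs_fderiv_le (hu : ConcaveOn ℝ s u) (hcont : ContinuousOn u s)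
    {h : E} {N : ℝ} (hN : ∀ᵐ z ∂μ.restrict s, |fderiv ℝ u z h| ≤ N) {b : E} {r : ℝ}
    (hb : b ∈ s) (ha : b + r • h ∈ interior s) : u (b + r • h) ≤ u b + N * |r| := by
  set D := {z ∈ interior s | DifferentiableAt ℝ u z ∧ |fderiv ℝ u z h| ≤ N}
  have hbD : b ∈ closure D := by
    have hbs : b ∈ closure (interior s) := by
      rw [hu.1.closure_interior_eq_closure_of_nonempty_interior ⟨_, ha⟩]
      exact subset_closure hb
    exact closure_minimal (interior_subset_closure_differentiableAt_of_concaveOn hu hN)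
      isClosed_closure hbs
  have : (𝓝[D] b).NeBot := mem_closure_iff_nhdsWithin_neBot.1 hbD
  have hshift : Tendsto (fun z => z + r • h) (𝓝[D] b) (𝓝 (b + r • h)) :=
    (Continuous.tendsto (by fun_prop) b).mono_left nhdsWithin_le_nhds
  have hlim_shift : Tendsto (fun z => u (z + r • h)) (𝓝[D] b) (𝓝 (u (b + r • h))) :=
    (hcont.continuousAt (mem_interior_iff_mem_nhds.1 ha)).tendsto.comp hshift
  have hlim : Tendsto (fun z => u z + N * |r|) (𝓝[D] b) (𝓝 (u b + N * |r|)) :=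
    ((hcont b hb).mono fun z hz => interior_subset hz.1).tendsto.add_const _
  refine le_of_tendsto_of_tendsto hlim_shift hlim ?_
  filter_upwards [self_mem_nhdsWithin, hshift (isOpen_interior.mem_nhds ha)]
    with z ⟨hz, hdiff, hzN⟩ hz'
  calc u (z + r • h) ≤ u z + fderiv ℝ u z (r • h) :=
        le_add_fderiv_of_concaveOn hu (interior_subset hz) (interior_subset hz') hdiff
    _ ≤ u z + |fderiv ℝ u z h| * |r| := by
        rw [map_smul, smul_eq_mul, mul_comm r, ← abs_mul]
        gcongr
        exact le_abs_self _
    _ ≤ u z + N * |r| := by gcongr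

end Concave

section Compact

variable {E : Type*} [NormedAddCommGroup E] [NormedSpace ℝ E] {s : Set E}

theorem exists_nonneg_add_smul_mem_frontier (hs : IsCompact s) {z h : E} (hz : z ∈ s)
    (hh : h ≠ 0) : ∃ r : ℝ, 0 ≤ r ∧ z + r • h ∈ frontier s := by
  have hline : IsClosedEmbedding fun r : ℝ => z + r • h :=
    (Homeomorph.addLeft z).isClosedEmbedding.comp (isClosedEmbedding_smul_left hh)
  have h0 : (0 : ℝ) ∈ (fun r : ℝ => z + r • h) ⁻¹' s := by simpa using hz
  obtain ⟨r, hr, hmax⟩ := (hline.isCompact_preimage hs).exists_isGreatest ⟨0, h0⟩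
  refine ⟨r, hmax h0, hline.continuous.frontier_preimage_subset s ?_⟩
  rw [mem_frontier_iff_notMem_interior hr, mem_interior_iff_mem_nhds]
  intro hnhds
  obtain ⟨r', hrr', hr'⟩ := Eventually.exists_gt hnhds
  exact hrr'.not_ge (hmax hr')

theorem exists_mem_segment_frontier [Nontrivial E] (hs : IsCompact s) {z : E} (hz : z ∈ s) :
    ∃ x ∈ frontier s, ∃ y ∈ frontier s, z ∈ segment ℝ x y := by
  obtain ⟨h, hh⟩ := exists_ne (0 : E)
  obtain ⟨r, hr, hx⟩ := exists_nonneg_add_smul_mem_frontier hs hz hh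
  obtain ⟨r', hr', hy⟩ := exists_nonneg_add_smul_mem_frontier hs hz (neg_ne_zero.2 hh)
  refine ⟨_, hx, _, hy, mem_segment_iff_wbtw.2 ?_⟩
  simpa [add_comm] using
    (wbtw_smul_vadd_smul_vadd_of_nonpos_of_nonneg z h (neg_nonpos.2 hr') hr).symm

end Compact

theorem IsConvexDomain.admissibleNonzero_nonempty {Ω : Set Plane} (hΩ : IsConvexDomain Ω) :
    (admissibleNonzero Ω).Nonempty := by
  obtain ⟨c, hc⟩ := hΩ.interior_nonempty
  set s := Homeomorph.addRight c ⁻¹' Ω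
  have hconv : Convex ℝ s := hΩ.convex.translate_preimage_left c
  have hnhds : s ∈ 𝓝 0 := by
    refine (Homeomorph.addRight c).continuous.continuousAt.preimage_mem_nhds ?_
    simpa using mem_interior_iff_mem_nhds.1 hc
  set u : Plane → ℝ := fun z => 1 - gauge s (z - c)
  have hconcave : ConcaveOn ℝ univ u := by
    simpa [u, Function.comp_def, sub_eq_add_neg] using
      (concaveOn_one_sub_gauge hconv (absorbent_nhds_zero hnhds)).translate_left (-c)
  obtain ⟨K, hK⟩ := hconv.lipschitz_gauge hnhds
  have hLip : LipschitzWith K u := by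
    simpa [u] using (LipschitzWith.const (1 : ℝ)).sub
      (hK.comp (LipschitzWith.id.sub (LipschitzWith.const c)))
  refine ⟨u, ⟨hLip.continuous.continuousOn, hconcave.subset (subset_univ _) hΩ.convex,
    fun z hz => sub_eq_zero.2 (Eq.symm ?_), K, fun z _ _ => norm_fderiv_le_of_lipschitz ℝ hLip⟩,
    c, interior_subset hc, by simp [u]⟩
  rw [gauge_eq_one_iff_mem_frontier hconv hnhds, ← Homeomorph.preimage_frontier]
  simpa using hz

theorem dirNorm_smul (p : ℝ≥0∞) (Ω : Set Plane) (u : Plane → ℝ) (m : ℝ) (h : Plane) :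
    dirNorm p Ω u (m • h) = ‖m‖ₑ * dirNorm p Ω u h := by
  simp only [dirNorm, map_smul]
  exact eLpNorm_const_smul m _ p _

theorem dirNorm_top_le {Ω : Set Plane} {u : Plane → ℝ} {h : Plane} {C : ℝ≥0∞}
    (hΩ : Convex ℝ Ω) (hC : ∀ z ∈ interior Ω, DifferentiableAt ℝ u z → ‖fderiv ℝ u z h‖ₑ ≤ C) :
    dirNorm ∞ Ω u h ≤ C := by
  rw [dirNorm, eLpNorm_exponent_top]
  refine eLpNormEssSup_le_of_ae_enorm_bound ?_
  filter_upwards [ae_mem_interior_of_convex hΩ] with z hz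
  by_cases hdiff : DifferentiableAt ℝ u z
  · exact hC z hz hdiff
  · simp [fderiv_zero_of_not_differentiableAt hdiff]

namespace IsAdmissible

variable {Ω : Set Plane} {u : Plane → ℝ}

theorem nonneg (hΩ : IsCompact Ω) (hu : IsAdmissible Ω u) {z : Plane} (hz : z ∈ Ω) :
    0 ≤ u z := by
  obtain ⟨x, hx, y, hy, hzxy⟩ := exists_mem_segment_frontier hΩ hz
  have hfrontier := hΩ.isClosed.frontier_subset
  simpa [hu.eq_zero_of_mem_frontier _ hx, hu.eq_zero_of_mem_frontier _ hy] using
    hu.concaveOn.ge_on_segment (hfrontier hx) (hfrontier hy) hzxy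

theorem dirNorm_top_lt_top (hu : IsAdmissible Ω u) (h : Plane) : dirNorm ∞ Ω u h < ∞ := by
  obtain ⟨C, hC⟩ := hu.gradient_bounded
  have hle : dirNorm ∞ Ω u h ≤ ENNReal.ofReal (C * ‖h‖) := by
    refine dirNorm_top_le hu.concaveOn.1 fun z hz hdiff => ?_
    rw [← ofReal_norm]
    exact ENNReal.ofReal_le_ofReal ((fderiv ℝ u z).le_of_opNorm_le (hC z hz hdiff) h)
  exact hle.trans_lt ENNReal.ofReal_lt_top

theorem ae_abs_fderiv_le (hu : IsAdmissible Ω u) (h : Plane) :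
    ∀ᵐ z ∂volume.restrict Ω, |fderiv ℝ u z h| ≤ (dirNorm ∞ Ω u h).toReal := by
  have hbound : ∀ᵐ z ∂volume.restrict Ω, ‖fderiv ℝ u z h‖ₑ ≤ dirNorm ∞ Ω u h := by
    rw [dirNorm, eLpNorm_exponent_top]
    exact ae_le_eLpNormEssSup
  filter_upwards [hbound] with z hz
  simpa using ENNReal.toReal_mono (hu.dirNorm_top_lt_top h).ne hz

theorem neg_fderiv_le_of_mem_frontier (hΩ : IsClosed Ω) (hu : IsAdmissible Ω u)
    {h k z : Plane} {T N : ℝ} (hN : ∀ᵐ z ∂volume.restrict Ω, |fderiv ℝ u z k| ≤ N)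
    (hz : z ∈ interior Ω) (hdiff : DifferentiableAt ℝ u z) (hT : 0 < T)
    (hy : z + T • h ∈ frontier Ω) (hx : z + (T / 2) • (h - k) ∈ frontier Ω) :
    -(fderiv ℝ u z h) ≤ N := by
  set y := z + T • h with hy_def
  set x := z + (T / 2) • (h - k)
  have hfrontier := hΩ.frontier_subset
  have hmid : (1 / 2 : ℝ) • z + (1 / 2 : ℝ) • y = x + (T / 2) • k := by module
  have hmem : x + (T / 2) • k ∈ interior Ω :=
    hmid ▸ hu.concaveOn.1.combo_interior_self_mem_interior hz (hfrontier hy) one_half_pos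
      one_half_pos.le (add_halves 1)
  have hcombo : u z / 2 ≤ u (x + (T / 2) • k) := by
    have := hu.concaveOn.2 (interior_subset hz) (hfrontier hy) one_half_pos.le one_half_pos.le
      (add_halves 1)
    rw [hmid, hu.eq_zero_of_mem_frontier y hy, smul_zero, add_zero, smul_eq_mul] at this
    linarith
  have hincr : u (x + (T / 2) • k) ≤ N * (T / 2) := by
    simpa [hu.eq_zero_of_mem_frontier x hx, abs_of_pos (half_pos hT)] using
      le_add_mul_abs_of_ae_abs_fderiv_le hu.concaveOn hu.continuousOn hN (hfrontier hx) hmem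
  have htangent : 0 ≤ u z + T * fderiv ℝ u z h := by
    simpa [← hy_def, hu.eq_zero_of_mem_frontier y hy] using
      le_add_fderiv_of_concaveOn hu.concaveOn (interior_subset hz) (hfrontier hy) hdiff
  refine le_of_mul_le_mul_left ?_ hT
  linarith

theorem neg_fderiv_le_of_forall_mem_frontier (hΩ : IsCompact Ω) (hu : IsAdmissible Ω u)
    {h k z : Plane} {N : ℝ} (hN : ∀ᵐ z ∂volume.restrict Ω, |fderiv ℝ u z k| ≤ N) (hh : h ≠ 0)
    (hz : z ∈ interior Ω) (hdiff : DifferentiableAt ℝ u z)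
    (hexit : ∀ T : ℝ, z + T • h ∈ frontier Ω →
      z + (T / 2) • (h + k) ∈ frontier Ω ∨ z + (T / 2) • (h - k) ∈ frontier Ω) :
    -(fderiv ℝ u z h) ≤ N := by
  obtain ⟨T, hT, hy⟩ := exists_nonneg_add_smul_mem_frontier hΩ (interior_subset hz) hh
  have hTpos : 0 < T := by
    refine hT.lt_of_ne' fun hzero => ?_
    rw [hzero, zero_smul, add_zero] at hy
    exact hy.2 hz
  rcases hexit T hy with hx | hx
  · refine hu.neg_fderiv_le_of_mem_frontier hΩ.isClosed (k := -k) ?_ hz hdiff hTpos hy ?_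
    · simpa using hN
    · simpa using hx
  · exact hu.neg_fderiv_le_of_mem_frontier hΩ.isClosed hN hz hdiff hTpos hy hx

theorem dirNorm_top_le_dirNorm_top (hΩ : IsCompact Ω) (hu : IsAdmissible Ω u) {h k : Plane}
    (hexit : ∀ z ∈ interior Ω, ∀ T : ℝ, z + T • h ∈ frontier Ω →
      z + (T / 2) • (h + k) ∈ frontier Ω ∨ z + (T / 2) • (h - k) ∈ frontier Ω) :
    dirNorm ∞ Ω u h ≤ dirNorm ∞ Ω u k := by
  rcases eq_or_ne h 0 with rfl | hh
  · simp only [dirNorm, map_zero, eLpNorm_zero', zero_le]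
  refine dirNorm_top_le hu.concaveOn.1 fun z hz hdiff => ?_
  rw [Real.enorm_eq_ofReal_abs,
    ENNReal.ofReal_le_iff_le_toReal (hu.dirNorm_top_lt_top k).ne, abs_le']
  have hN := hu.ae_abs_fderiv_le k
  constructor
  · have hneg := hu.neg_fderiv_le_of_forall_mem_frontier hΩ (h := -h) (k := k) hN
      (neg_ne_zero.2 hh) hz hdiff fun T hT => ?_
    · simpa using hneg
    · have := hexit z hz (-T) (by simpa using hT)
      rw [or_comm]
      convert this using 3 <;> module
  · exact hu.neg_fderiv_le_of_forall_mem_frontier hΩ hN hh hz hdiff (hexit z hz)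

end IsAdmissible

section Parallelogram

variable {c v w : Plane}

/-- The affine coordinates `(s, t) ↦ c + s • v + t • w` of the plane, in which the parallelogram
`parallelogram c v w` is the unit square. -/
noncomputable def parallelogramChart (c : Plane) (h : LinearIndependent ℝ ![v, w]) :
    (ℝ × ℝ) ≃ᴬ[ℝ] Plane :=
  let e := (LinearEquiv.finTwoArrow ℝ ℝ).symm ≪≫ₗ
    (basisOfLinearIndependentOfCardEqFinrank h (by simp)).equivFun.symm
  e.toContinuousLinearEquiv.toContinuousAffineEquiv.trans (.constVAdd ℝ Plane c)

theorem parallelogramChart_apply (c : Plane) (h : LinearIndependent ℝ ![v, w]) (x : ℝ × ℝ) :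
    parallelogramChart c h x = c + x.1 • v + x.2 • w := by
  have hconst (y : Plane) : ContinuousAffineEquiv.constVAdd ℝ Plane c y = c + y := rfl
  simp [parallelogramChart, hconst, Module.Basis.equivFun_symm_apply, add_assoc]

theorem image_parallelogramChart (c : Plane) (h : LinearIndependent ℝ ![v, w]) :
    parallelogramChart c h '' (Icc 0 1 ×ˢ Icc 0 1) = parallelogram c v w := by
  ext z
  simp only [parallelogram, mem_image, mem_prod, Prod.exists, parallelogramChart_apply,
    mem_ofPred_eq, eq_comm (a := z)]
  exact ⟨fun ⟨s, t, ⟨hs, ht⟩, hz⟩ => ⟨s, hs, t, ht, hz⟩,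
    fun ⟨s, hs, t, ht, hz⟩ => ⟨s, t, ⟨hs, ht⟩, hz⟩⟩

theorem image_parallelogramChart_Ioo (c : Plane) (h : LinearIndependent ℝ ![v, w]) :
    parallelogramChart c h '' (Ioo 0 1 ×ˢ Ioo 0 1) = interior (parallelogram c v w) := by
  rw [← image_parallelogramChart c h, ← interior_Icc, ← interior_prod_eq]
  exact (parallelogramChart c h).toHomeomorph.image_interior _

theorem isConvexDomain_parallelogram (c : Plane) (h : LinearIndependent ℝ ![v, w]) :
    IsConvexDomain (parallelogram c v w) where
  isCompact := by
    rw [← image_parallelogramChart c h]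
    exact (isCompact_Icc.prod isCompact_Icc).image (parallelogramChart c h).continuous
  convex := by
    rw [← image_parallelogramChart c h]
    exact ((convex_Icc 0 1).prod (convex_Icc 0 1)).affine_image
      (parallelogramChart c h).toAffineEquiv.toAffineMap
  interior_nonempty := by
    rw [← image_parallelogramChart_Ioo c h]
    exact ((nonempty_Ioo.2 zero_lt_one).prod (nonempty_Ioo.2 zero_lt_one)).image _

theorem add_smul_add_smul_mem_parallelogram_iff (h : LinearIndependent ℝ ![v, w]) {s t : ℝ} :
    c + s • v + t • w ∈ parallelogram c v w ↔ s ∈ Icc 0 1 ∧ t ∈ Icc 0 1 := by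
  rw [← image_parallelogramChart c h, ← parallelogramChart_apply c h (s, t),
    (parallelogramChart c h).injective.mem_set_image, mem_prod]

theorem add_smul_add_smul_mem_interior_parallelogram_iff (h : LinearIndependent ℝ ![v, w])
    {s t : ℝ} :
    c + s • v + t • w ∈ interior (parallelogram c v w) ↔ s ∈ Ioo 0 1 ∧ t ∈ Ioo 0 1 := by
  rw [← image_parallelogramChart_Ioo c h, ← parallelogramChart_apply c h (s, t),
    (parallelogramChart c h).injective.mem_set_image, mem_prod]

theorem add_smul_mem_frontier_parallelogram_or (h : LinearIndependent ℝ ![v, w]) {z : Plane}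
    {σ τ : ℝ} (hz : z ∈ interior (parallelogram c v w))
    (hy : z + σ • v + τ • w ∈ frontier (parallelogram c v w)) :
    z + σ • v ∈ frontier (parallelogram c v w) ∨ z + τ • w ∈ frontier (parallelogram c v w) := by
  have hclosed := (isConvexDomain_parallelogram c h).isCompact.isClosed
  obtain ⟨s, -, t, -, rfl⟩ := interior_subset hz
  have hy_eq : c + s • v + t • w + σ • v + τ • w = c + (s + σ) • v + (t + τ) • w := by module
  have hv_eq : c + s • v + t • w + σ • v = c + (s + σ) • v + t • w := by module
  have hw_eq : c + s • v + t • w + τ • w = c + s • v + (t + τ) • w := by module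
  rw [hy_eq] at hy
  simp only [hv_eq, hw_eq, hclosed.frontier_eq, Set.mem_sdiff,
    add_smul_add_smul_mem_parallelogram_iff h,
    add_smul_add_smul_mem_interior_parallelogram_iff h] at hz hy ⊢
  have := Ioo_subset_Icc_self hz.1
  have := Ioo_subset_Icc_self hz.2
  tauto

variable {u : Plane → ℝ} {h₁ h₂ : Plane}

theorem dirNorm_parallelogram_le (h : LinearIndependent ℝ ![v, w])
    (hu : IsAdmissible (parallelogram c v w) u)
    (hv : ∃ a : ℝ, v = a • (h₁ + h₂)) (hw : ∃ b : ℝ, w = b • (h₁ - h₂)) :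
    dirNorm ∞ (parallelogram c v w) u h₁ ≤ dirNorm ∞ (parallelogram c v w) u h₂ := by
  refine hu.dirNorm_top_le_dirNorm_top (isConvexDomain_parallelogram c h).isCompact
    fun z hz T hT => ?_
  obtain ⟨a, ha⟩ := hv
  obtain ⟨b, hb⟩ := hw
  have ha0 : a ≠ 0 := fun h0 => h.ne_zero 0 (by simp [ha, h0])
  have hb0 : b ≠ 0 := fun h0 => h.ne_zero 1 (by simp [hb, h0])
  have hv : (T / 2) • (h₁ + h₂) = (T / 2 / a) • v := by
    rw [ha, smul_smul, div_mul_cancel₀ _ ha0]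
  have hw : (T / 2) • (h₁ - h₂) = (T / 2 / b) • w := by
    rw [hb, smul_smul, div_mul_cancel₀ _ hb0]
  have hsum : z + T • h₁ = z + (T / 2) • (h₁ + h₂) + (T / 2) • (h₁ - h₂) := by module
  rw [hsum, hv, hw] at hT
  rw [hv, hw]
  exact add_smul_mem_frontier_parallelogram_or h hz hT

theorem dirNorm_parallelogram_eq (h : LinearIndependent ℝ ![v, w])
    (hu : IsAdmissible (parallelogram c v w) u)
    (hv : ∃ a : ℝ, v = a • (h₁ + h₂)) (hw : ∃ b : ℝ, w = b • (h₁ - h₂)) :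
    dirNorm ∞ (parallelogram c v w) u h₁ = dirNorm ∞ (parallelogram c v w) u h₂ := by
  refine (dirNorm_parallelogram_le h hu hv hw).antisymm (dirNorm_parallelogram_le h hu ?_ ?_)
  · rwa [add_comm h₂]
  · obtain ⟨b, hb⟩ := hw
    exact ⟨-b, by rw [hb, neg_smul, ← smul_neg, neg_sub]⟩

end Parallelogram

section Ratio

variable {Ω : Set Plane} {h₁ h₂ : Plane}

theorem dirNorm_top_ne_zero (hΩ : IsCompact Ω) {u : Plane → ℝ}
    (hu : u ∈ admissibleNonzero Ω) {h : Plane} (hh : h ≠ 0) : dirNorm ∞ Ω u h ≠ 0 := by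
  obtain ⟨hu, z, hz, huz⟩ := hu
  intro hzero
  have hN := hu.ae_abs_fderiv_le h
  rw [hzero, ENNReal.toReal_zero] at hN
  have hzi : z ∈ interior Ω := by
    by_contra hzi
    exact huz (hu.eq_zero_of_mem_frontier z ⟨subset_closure hz, hzi⟩)
  obtain ⟨r, -, hr⟩ := exists_nonneg_add_smul_mem_frontier hΩ hz hh
  have hle : u z ≤ u (z + r • h) := by
    simpa using le_add_mul_abs_of_ae_abs_fderiv_le hu.concaveOn hu.continuousOn hN (r := -r)
      (hΩ.isClosed.frontier_subset hr) (by simpa using hzi)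
  rw [hu.eq_zero_of_mem_frontier _ hr] at hle
  exact huz (hle.antisymm (hu.nonneg hΩ hz))

theorem dirNorm_div_dirNorm_ne_zero (hΩ : IsCompact Ω) (h₁0 : h₁ ≠ 0) {u : Plane → ℝ}
    (hu : u ∈ admissibleNonzero Ω) : dirNorm ∞ Ω u h₁ / dirNorm ∞ Ω u h₂ ≠ 0 :=
  ENNReal.div_ne_zero.2 ⟨dirNorm_top_ne_zero hΩ hu h₁0, (hu.1.dirNorm_top_lt_top h₂).ne⟩

theorem dirNorm_div_dirNorm_ne_top (hΩ : IsCompact Ω) (h₂0 : h₂ ≠ 0) {u : Plane → ℝ}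
    (hu : u ∈ admissibleNonzero Ω) : dirNorm ∞ Ω u h₁ / dirNorm ∞ Ω u h₂ ≠ ∞ :=
  ENNReal.div_ne_top (hu.1.dirNorm_top_lt_top h₁).ne (dirNorm_top_ne_zero hΩ hu h₂0)

theorem one_le_supRatio_div_infRatio (hΩ : IsConvexDomain Ω) (h₁0 : h₁ ≠ 0) (h₂0 : h₂ ≠ 0) :
    1 ≤ supRatio ∞ Ω h₁ h₂ / infRatio ∞ Ω h₁ h₂ := by
  obtain ⟨u, hu⟩ := hΩ.admissibleNonzero_nonempty
  set r := dirNorm ∞ Ω u h₁ / dirNorm ∞ Ω u h₂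
  have hr : r ≤ supRatio ∞ Ω h₁ h₂ :=
    le_iSup₂ (f := fun u (_ : u ∈ admissibleNonzero Ω) => dirNorm ∞ Ω u h₁ / dirNorm ∞ Ω u h₂) u hu
  calc 1 = r / r := (ENNReal.div_self (dirNorm_div_dirNorm_ne_zero hΩ.isCompact h₁0 hu)
        (dirNorm_div_dirNorm_ne_top hΩ.isCompact h₂0 hu)).symm
    _ ≤ supRatio ∞ Ω h₁ h₂ / infRatio ∞ Ω h₁ h₂ := ENNReal.div_le_div hr (iInf₂_le u hu)

theorem supRatio_div_infRatio_eq_one_of_forall_dirNorm_eq_mul (hΩ : IsConvexDomain Ω)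
    (h₁0 : h₁ ≠ 0) (h₂0 : h₂ ≠ 0) {κ : ℝ≥0∞}
    (hκ : ∀ u ∈ admissibleNonzero Ω, dirNorm ∞ Ω u h₁ = κ * dirNorm ∞ Ω u h₂) :
    supRatio ∞ Ω h₁ h₂ / infRatio ∞ Ω h₁ h₂ = 1 := by
  have hratio : ∀ u ∈ admissibleNonzero Ω, dirNorm ∞ Ω u h₁ / dirNorm ∞ Ω u h₂ = κ := by
    intro u hu
    rw [hκ u hu]
    exact ENNReal.mul_div_cancel_right (dirNorm_top_ne_zero hΩ.isCompact hu h₂0)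
      (hu.1.dirNorm_top_lt_top h₂).ne
  have hne := hΩ.admissibleNonzero_nonempty
  have hsup : supRatio ∞ Ω h₁ h₂ = κ := (biSup_congr hratio).trans (biSup_const hne)
  have hinf : infRatio ∞ Ω h₁ h₂ = κ := (biInf_congr hratio).trans (biInf_const hne)
  obtain ⟨u, hu⟩ := hne
  rw [hsup, hinf, ← hratio u hu]
  exact ENNReal.div_self (dirNorm_div_dirNorm_ne_zero hΩ.isCompact h₁0 hu)
    (dirNorm_div_dirNorm_ne_top hΩ.isCompact h₂0 hu)

theorem supRatio_div_infRatio_parallelogram {c v w : Plane} (h : LinearIndependent ℝ ![v, w])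
    (h₁0 : h₁ ≠ 0) (h₂0 : h₂ ≠ 0) {m : ℝ} (hv : ∃ a : ℝ, v = a • (h₁ + m • h₂))
    (hw : ∃ b : ℝ, w = b • (h₁ - m • h₂)) :
    supRatio ∞ (parallelogram c v w) h₁ h₂ / infRatio ∞ (parallelogram c v w) h₁ h₂ = 1 := by
  refine supRatio_div_infRatio_eq_one_of_forall_dirNorm_eq_mul (isConvexDomain_parallelogram c h)
    h₁0 h₂0 (κ := ‖m‖ₑ) fun u hu => ?_
  rw [← dirNorm_smul]
  exact dirNorm_parallelogram_eq h hu.1 hv hw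

theorem exists_supRatio_div_infRatio_eq_one (h₁0 : h₁ ≠ 0) (h₂0 : h₂ ≠ 0) :
    ∃ Ω, IsConvexDomain Ω ∧ supRatio ∞ Ω h₁ h₂ / infRatio ∞ Ω h₁ h₂ = 1 := by
  obtain ⟨Ω, hΩ⟩ : ∃ Ω, IsConvexDomain Ω :=
    ⟨Metric.closedBall 0 1, isCompact_closedBall 0 1, convex_closedBall 0 1, 0,
      Metric.ball_subset_interior_closedBall (Metric.mem_ball_self one_pos)⟩
  by_cases hcollinear : ∃ m : ℝ, m • h₂ = h₁
  · obtain ⟨m, rfl⟩ := hcollinear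
    exact ⟨Ω, hΩ, supRatio_div_infRatio_eq_one_of_forall_dirNorm_eq_mul hΩ h₁0 h₂0
      fun u _ => dirNorm_smul ∞ Ω u m h₂⟩
  · have hli : LinearIndependent ℝ ![h₁ + h₂, h₁ - h₂] := by
      have hpair := (LinearIndependent.pair_iff' h₂0).2 (not_exists.1 hcollinear)
      simpa only [one_smul, neg_smul, ← sub_eq_add_neg] using
        (LinearIndependent.pair_add_smul_add_smul_iff (1 : ℝ) 1 1 (-1)).2
          ⟨LinearIndependent.pair_symm_iff.1 hpair, by norm_num⟩
    exact ⟨parallelogram 0 (h₁ + h₂) (h₁ - h₂), isConvexDomain_parallelogram 0 hli,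
      supRatio_div_infRatio_parallelogram hli h₁0 h₂0 (m := 1) ⟨1, by simp⟩ ⟨1, by simp⟩⟩

theorem iInf_supRatio_div_infRatio (h₁0 : h₁ ≠ 0) (h₂0 : h₂ ≠ 0) :
    (⨅ (Ω : Set Plane) (_ : IsConvexDomain Ω),
      supRatio ∞ Ω h₁ h₂ / infRatio ∞ Ω h₁ h₂) = 1 := by
  obtain ⟨Ω, hΩ, hone⟩ := exists_supRatio_div_infRatio_eq_one h₁0 h₂0
  exact le_antisymm (hone ▸ iInf₂_le Ω hΩ)
    (le_iInf₂ fun Ω' hΩ' => one_le_supRatio_div_infRatio hΩ' h₁0 h₂0)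

end Ratio

theorem dirX_ne_zero : dirX ≠ 0 := by
  simp [dirX]

theorem dirY_ne_zero : dirY ≠ 0 := by
  simp [dirY]

theorem eq_smul_dirX_add_smul_dirY {v : Plane} (hv : v 0 ≠ 0) :
    v = v 0 • (dirX + (v 1 / v 0) • dirY) := by
  ext i
  fin_cases i <;> simp [dirX, dirY, mul_div_cancel₀ _ hv]

theorem slope_eq_neg_slope_of_abs_eq {v w : Plane} (h : LinearIndependent ℝ ![v, w])
    (hv : v 0 ≠ 0) (hw : w 0 ≠ 0) (hslope : |v 1 / v 0| = |w 1 / w 0|) :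
    w 1 / w 0 = -(v 1 / v 0) := by
  refine (abs_eq_abs.1 hslope.symm).resolve_left fun heq => ?_
  have hcollinear : (w 0 / v 0) • v = w := by
    calc (w 0 / v 0) • v = (w 0 / v 0) • v 0 • (dirX + (v 1 / v 0) • dirY) :=
          congrArg _ (eq_smul_dirX_add_smul_dirY hv)
      _ = w 0 • (dirX + (w 1 / w 0) • dirY) := by rw [smul_smul, div_mul_cancel₀ _ hv, heq]
      _ = w := (eq_smul_dirX_add_smul_dirY hw).symm
  exact (LinearIndependent.pair_iff' (h.ne_zero 0)).1 h _ hcollinear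

theorem bigK_div_smallK_parallelogram {c v w : Plane} (h : LinearIndependent ℝ ![v, w])
    (hv : v 0 ≠ 0) (hw : w 0 ≠ 0) (hslope : |v 1 / v 0| = |w 1 / w 0|) :
    bigK ∞ (parallelogram c v w) / smallK ∞ (parallelogram c v w) = 1 := by
  refine supRatio_div_infRatio_parallelogram h dirX_ne_zero dirY_ne_zero
    ⟨_, eq_smul_dirX_add_smul_dirY hv⟩ ⟨w 0, ?_⟩
  rw [sub_eq_add_neg, ← neg_smul, ← slope_eq_neg_slope_of_abs_eq h hv hw hslope]
  exact eq_smul_dirX_add_smul_dirY hw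

theorem mainTheorem11 :
    ((⨅ (Ω : Set Plane) (_ : IsConvexDomain Ω), bigK ∞ Ω / smallK ∞ Ω) = 1 ∧
      ∀ c v w : Plane, LinearIndependent ℝ ![v, w] →
        v 0 ≠ 0 → w 0 ≠ 0 → |v 1 / v 0| = |w 1 / w 0| →
          IsConvexDomain (parallelogram c v w) ∧
            bigK ∞ (parallelogram c v w) / smallK ∞ (parallelogram c v w) = 1) ∧
    ∀ h₁ h₂ : Plane, h₁ ≠ 0 → h₂ ≠ 0 →
      (⨅ (Ω : Set Plane) (_ : IsConvexDomain Ω),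
        supRatio ∞ Ω h₁ h₂ / infRatio ∞ Ω h₁ h₂) = 1 ∧
      ∀ c v w : Plane, LinearIndependent ℝ ![v, w] →
        (∃ a : ℝ, v = a • (h₁ + h₂)) → (∃ b : ℝ, w = b • (h₁ - h₂)) →
          IsConvexDomain (parallelogram c v w) ∧
            supRatio ∞ (parallelogram c v w) h₁ h₂ / infRatio ∞ (parallelogram c v w) h₁ h₂ = 1 := by
  refine ⟨⟨iInf_supRatio_div_infRatio dirX_ne_zero dirY_ne_zero, fun c v w h hv hw hslope => ?_⟩,
    fun h₁ h₂ h₁0 h₂0 => ⟨iInf_supRatio_div_infRatio h₁0 h₂0, fun c v w h hv hw => ?_⟩⟩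
  · exact ⟨isConvexDomain_parallelogram c h, bigK_div_smallK_parallelogram h hv hw hslope⟩
  · exact ⟨isConvexDomain_parallelogram c h,
      supRatio_div_infRatio_parallelogram h h₁0 h₂0 (m := 1) (by simpa only [one_smul])
        (by simpa only [one_smul])⟩
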